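/- Let $(F_M)_{M\ge 1}$ be a sequence of (deterministic) cumulative distribution functions on $\mathbb{R}$, and let $(\tilde F_M)_{M\ge 1}$ be a sequence of random cumulative distribution functions defined on a common probability space $(\Omega,\mathcal{A},\mathbb{P})$. For a CDF $G$ write $\mu_K(G)=\int x^K\,dG(x)$ for its $K$th moment; assume that each $F_M$ has finite moments of all orders, and that each $\tilde F_M$ almost surely has finite moments of all orders. Assume the following. (a) Bounded moments: there is a constant $L\ge 0$ such that $\limsup_{M\to\infty}\mu_K(F_M)\le L^K K!$ for every $K\in\mathbb{N}$. (b) Convergence of moments: for every $k\in\mathbb{N}$, $\mu_k(\tilde F_M)-\mu_k(F_M)\to 0$ in probability as $M\to\infty$. (c) Anticoncentration: there is a constant $\xi>0$ such that $\limsup_{M\to\infty}|F_M(b)-F_M(a)|\le \xi|a-b|$ for all $a,b\in\mathbb{R}$. Then the following hold. 1. $\sup_{x\in\mathbb{R}}|F_M(x)-\tilde F_M(x)|\to 0$ in probability as $M\to\infty$. 2. Let $\Delta_M$ be random variables on the same probability space with $\Delta_M\sim F_M$ for every $M$ (no assumption is made on the joint law of $\Delta_M$ and $\tilde F_M$), let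 $\alpha\in(0,1)$, and let $\tilde F_M^{-1}(1-\alpha)=\inf\{x\in\mathbb{R}:\tilde F_M(x)\ge 1-\alpha\}$. Then $$\limsup_{M\to\infty}\mathbb{P}\bigl(\Delta_M>\tilde F_M^{-1}(1-\alpha)\bigr)\le\alpha.$$ 3. If in addition, in the setting of 2, $\limsup_{M\to\infty}\mathbb{P}\bigl(\Delta_M=\tilde F_M^{-1}(1-\alpha)\bigr)=0$, then $$\lim_{M\to\infty}\mathbb{P}\bigl(\Delta_M>\tilde F_M^{-1}(1-\alpha)\bigr)=\alpha.$$ -/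

import Mathlib

open MeasureTheory ProbabilityTheory Filter Topology

/-- A cumulative distribution function on `ℝ`: a monotone right-continuous function (this is
what a `StieltjesFunction` is) with limits `0` at `-∞` and `1` at `+∞`. -/
structure IsCDF (F : StieltjesFunction ℝ) : Prop where
  tendsto_atBot : Tendsto F atBot (𝓝 0)
  tendsto_atTop : Tendsto F atTop (𝓝 1)

/-- A random CDF on `Ω`: each realization is a CDF, and the value at every point is a random
variable. -/
structure IsRandomCDF {Ω : Type*} [MeasurableSpace Ω] (G : Ω → StieltjesFunction ℝ) : Prop where
  isCDF : ∀ ω, IsCDF (G ω)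
  measurable : ∀ x : ℝ, Measurable fun ω => G ω x

/-- The moments of all orders of the distribution with CDF `F` exist and are finite. -/
def HasAllMoments (F : StieltjesFunction ℝ) : Prop :=
  ∀ K : ℕ, Integrable (fun x : ℝ => x ^ K) F.measure

/-- The `K`-th (raw) moment `∫ x ^ K dF(x)` of the distribution with CDF `F`. -/
noncomputable def cdfMoment (K : ℕ) (F : StieltjesFunction ℝ) : ℝ :=
  ∫ x : ℝ, x ^ K ∂F.measure

/-- The quantile (generalized inverse) `F⁻¹(p) = inf {x | p ≤ F x}`. If `F` is a CDF and
`0 < p < 1`, the set is non-empty and bounded below. -/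
noncomputable def cdfQuantile (F : StieltjesFunction ℝ) (p : ℝ) : ℝ :=
  sInf {x : ℝ | p ≤ F x}

/-- The Kolmogorov–Smirnov distance `sup_x |F x - G x|`; the supremum is over a bounded family
if `F` and `G` are CDFs. -/
noncomputable def ksDist (F G : StieltjesFunction ℝ) : ℝ :=
  ⨆ x : ℝ, |F x - G x|

/-- Taylor's formula for the exponential along the imaginary axis, with the optimal remainder. -/
lemma norm_cexp_mul_I_sub_sum_le (m : ℕ) (u : ℝ) :
    ‖Complex.exp (u * Complex.I) - ∑ j ∈ Finset.range m, (u * Complex.I) ^ j / (j.factorial : ℂ)‖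
      ≤ |u| ^ m / m.factorial := by
  suffices h : ∀ m : ℕ, ∀ t ∈ Set.Icc (0 : ℝ) 1,
      ‖Complex.exp ((t : ℂ) * (u * Complex.I)) -
        ∑ j ∈ Finset.range m, ((t : ℂ) * (u * Complex.I)) ^ j / (j.factorial : ℂ)‖
        ≤ (t * |u|) ^ m / m.factorial by
    simpa using h m 1 (by simp)
  intro m
  induction m with
  | zero =>
    intro t _
    have : (t : ℂ) * (u * Complex.I) = ((t * u : ℝ) : ℂ) * Complex.I := by push_cast; ring
    rw [this]
    simp [Complex.norm_exp_ofReal_mul_I, -Complex.ofReal_mul]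
  | succ m ih =>
    set w : ℂ := u * Complex.I with hw
    have hwn : ‖w‖ = |u| := by simp [hw]
    have hsum : ∀ t : ℝ, HasDerivAt
        (fun t : ℝ => ∑ j ∈ Finset.range (m + 1), ((t : ℂ) * w) ^ j / (j.factorial : ℂ))
        (w * ∑ j ∈ Finset.range m, ((t : ℂ) * w) ^ j / (j.factorial : ℂ)) t := by
      intro t
      have h1 : ∀ j ∈ Finset.range (m + 1), HasDerivAt
          (fun t : ℝ => ((t : ℂ) * w) ^ j / (j.factorial : ℂ))
          ((j : ℂ) * ((t : ℂ) * w) ^ (j - 1) * w / (j.factorial : ℂ)) t := by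
        intro j _
        have h0 : HasDerivAt (fun t : ℝ => (t : ℂ) * w) w t := by
          simpa using (Complex.ofRealCLM.hasDerivAt (x := t)).mul_const w
        exact (h0.pow j).div_const _
      have h2 := HasDerivAt.fun_sum h1
      refine h2.congr_deriv ?_
      rw [Finset.sum_range_succ', Finset.mul_sum]
      simp only [Nat.cast_zero, zero_mul, zero_div, add_zero, Nat.add_sub_cancel]
      refine Finset.sum_congr rfl fun j _ => ?_
      rw [Nat.factorial_succ]
      have : (j.factorial : ℂ) ≠ 0 := by exact_mod_cast j.factorial_ne_zero
      have : ((j : ℂ) + 1) ≠ 0 := by exact_mod_cast j.succ_ne_zero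
      push_cast
      field_simp
    have hexp : ∀ t : ℝ, HasDerivAt (fun t : ℝ => Complex.exp ((t : ℂ) * w))
        (w * Complex.exp ((t : ℂ) * w)) t := by
      intro t
      have h0 : HasDerivAt (fun t : ℝ => (t : ℂ) * w) w t := by
        simpa using (Complex.ofRealCLM.hasDerivAt (x := t)).mul_const w
      simpa [mul_comm] using h0.cexp
    have hd := fun t => (hexp t).sub (hsum t)
    have hB : ∀ t : ℝ, HasDerivAt (fun t : ℝ => (t * |u|) ^ (m + 1) / ((m + 1).factorial : ℝ))
        (|u| * ((t * |u|) ^ m / (m.factorial : ℝ))) t := by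
      intro t
      have h0 : HasDerivAt (fun t : ℝ => t * |u|) |u| t := by
        simpa using (hasDerivAt_id t).mul_const |u|
      refine ((h0.pow (m + 1)).div_const _).congr_deriv ?_
      rw [Nat.factorial_succ]
      have : (m.factorial : ℝ) ≠ 0 := by exact_mod_cast m.factorial_ne_zero
      have : ((m : ℝ) + 1) ≠ 0 := by exact_mod_cast m.succ_ne_zero
      push_cast
      field_simp
    intro t ht
    refine image_norm_le_of_norm_deriv_right_le_deriv_boundary (a := 0) (b := 1)
      (fun s _ => (hd s).continuousAt.continuousWithinAt)
      (fun s _ => (hd s).hasDerivWithinAt) ?_ hB ?_ ht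
    · simp [Finset.sum_range_succ']
    · intro s hs
      rw [← mul_sub, norm_mul, hwn]
      exact mul_le_mul_of_nonneg_left (ih s ⟨hs.1, hs.2.le⟩) (abs_nonneg u)

/-- The `k`-th derivative (up to the factor `I ^ k`) of the characteristic function. -/
noncomputable def charMoment (μ : Measure ℝ) (k : ℕ) (t : ℝ) : ℂ :=
  ∫ x : ℝ, (x : ℂ) ^ k * Complex.exp (t * x * Complex.I) ∂μ

lemma charMoment_zero_right (μ : Measure ℝ) (k : ℕ) :
    charMoment μ k 0 = ((∫ x : ℝ, x ^ k ∂μ : ℝ) : ℂ) := by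
  rw [← integral_complex_ofReal]
  simp [charMoment]

lemma charMoment_zero_left (μ : Measure ℝ) (t : ℝ) : charMoment μ 0 t = charFun μ t := by
  simp [charMoment, charFun_apply_real]

lemma integrable_pow_mul_cexp {μ : Measure ℝ} {k : ℕ}
    (h : Integrable (fun x : ℝ => x ^ k) μ) (t : ℝ) :
    Integrable (fun x : ℝ => (x : ℂ) ^ k * Complex.exp (t * x * Complex.I)) μ := by
  have h1 : Integrable (fun x : ℝ => ((x ^ k : ℝ) : ℂ)) μ := h.ofReal
  refine h1.mono (Continuous.aestronglyMeasurable (by fun_prop)) (Eventually.of_forall fun x => ?_)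
  rw [norm_mul, ← Complex.ofReal_mul, Complex.norm_exp_ofReal_mul_I]
  simp

/-- Re-expansion of `charMoment` around `t`. -/
lemma norm_charMoment_add_sub_sum_le {μ : Measure ℝ}
    (h : ∀ k : ℕ, Integrable (fun x : ℝ => x ^ k) μ) (k m : ℕ) (hkm : Even (k + m)) (t s : ℝ) :
    ‖charMoment μ k (t + s) - ∑ j ∈ Finset.range m,
        (s * Complex.I) ^ j / (j.factorial : ℂ) * charMoment μ (k + j) t‖
      ≤ |s| ^ m / m.factorial * ∫ x : ℝ, x ^ (k + m) ∂μ := by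
  have hsum : charMoment μ k (t + s) - ∑ j ∈ Finset.range m,
        (s * Complex.I) ^ j / (j.factorial : ℂ) * charMoment μ (k + j) t
      = ∫ x : ℝ, (x : ℂ) ^ k * Complex.exp (t * x * Complex.I) *
        (Complex.exp ((s * x : ℝ) * Complex.I) - ∑ j ∈ Finset.range m,
          ((s * x : ℝ) * Complex.I) ^ j / (j.factorial : ℂ)) ∂μ := by
    simp only [charMoment, ← integral_const_mul]
    rw [← integral_finsetSum _ fun j _ => (integrable_pow_mul_cexp (h (k + j)) t).const_mul _,
      ← integral_sub (integrable_pow_mul_cexp (h k) _)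
        (integrable_finsetSum _ fun j _ => (integrable_pow_mul_cexp (h (k + j)) t).const_mul _)]
    refine integral_congr_ae (Eventually.of_forall fun x => ?_)
    simp only
    rw [mul_sub, Finset.mul_sum, mul_assoc ((x : ℂ) ^ k), ← Complex.exp_add]
    congr 1
    · congr 2; push_cast; ring
    · refine Finset.sum_congr rfl fun j _ => ?_
      push_cast
      rw [mul_pow, mul_pow, mul_pow, pow_add]
      ring
  rw [hsum, ← integral_const_mul]
  refine norm_integral_le_of_norm_le ((h (k + m)).const_mul _) (Eventually.of_forall fun x => ?_)
  rw [norm_mul, norm_mul, ← Complex.ofReal_mul, Complex.norm_exp_ofReal_mul_I, mul_one, norm_pow,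
    Complex.norm_real, Real.norm_eq_abs]
  calc |x| ^ k * _ ≤ |x| ^ k * (|s * x| ^ m / m.factorial) := by
        gcongr
        exact norm_cexp_mul_I_sub_sum_le m (s * x)
    _ = |s| ^ m / m.factorial * |x| ^ (k + m) := by rw [abs_mul]; ring
    _ = |s| ^ m / m.factorial * x ^ (k + m) := by rw [hkm.pow_abs]

/-- If the moments of two sequences of measures merge and the even moments grow at most like
`C * B ^ K * K!`, then closeness of all `charMoment`s at `t` propagates to a neighbourhood of `t`
whose size depends on `B` only. -/
lemma tendsto_charMoment_sub_add {μ ν : ℕ → Measure ℝ}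
    (hμ : ∀ n k, Integrable (fun x : ℝ => x ^ k) (μ n))
    (hν : ∀ n k, Integrable (fun x : ℝ => x ^ k) (ν n)) {B C : ℝ} (hB : 0 < B) (hC : 0 < C)
    (hμB : ∀ K : ℕ, Even K → ∀ᶠ n in atTop, ∫ x : ℝ, x ^ K ∂(μ n) ≤ C * B ^ K * K.factorial)
    (hνB : ∀ K : ℕ, Even K → ∀ᶠ n in atTop, ∫ x : ℝ, x ^ K ∂(ν n) ≤ C * B ^ K * K.factorial)
    {t : ℝ} (ht : ∀ k, Tendsto (fun n => charMoment (μ n) k t - charMoment (ν n) k t) atTop (𝓝 0))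
    {s : ℝ} (hs : |s| ≤ 1 / (4 * B)) (k : ℕ) :
    Tendsto (fun n => charMoment (μ n) k (t + s) - charMoment (ν n) k (t + s)) atTop (𝓝 0) := by
  rw [Metric.tendsto_nhds]
  intro ε hε
  have hs' : 2 * B * |s| ≤ 1 / 2 := by
    calc 2 * B * |s| ≤ 2 * B * (1 / (4 * B)) := by gcongr
      _ = 1 / 2 := by field_simp; norm_num
  set A : ℝ := 2 * C * k.factorial * (2 * B) ^ k with hA
  have hApos : 0 < A := by positivity
  obtain ⟨m₀, hm₀⟩ := exists_pow_lt_of_lt_one (show 0 < ε / (2 * A) by positivity)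
    (show (1 / 2 : ℝ) < 1 by norm_num)
  set m := k + 2 * m₀ with hm
  have hev : Even (k + m) := ⟨k + m₀, by omega⟩
  have hrem : 2 * (|s| ^ m / m.factorial * (C * B ^ (k + m) * (k + m).factorial)) < ε / 2 := by
    have h1 : ((k + m).factorial : ℝ) ≤ 2 ^ (k + m) * (k.factorial * m.factorial) := by
      have := Nat.add_choose_mul_factorial_mul_factorial k m
      rw [← this]
      push_cast
      rw [mul_assoc]
      gcongr
      exact_mod_cast Nat.choose_le_two_pow (k + m) m
    have hmf : (0 : ℝ) < m.factorial := by exact_mod_cast m.factorial_pos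
    calc 2 * (|s| ^ m / m.factorial * (C * B ^ (k + m) * (k + m).factorial))
        ≤ 2 * (|s| ^ m / m.factorial *
            (C * B ^ (k + m) * (2 ^ (k + m) * (k.factorial * m.factorial)))) := by gcongr
      _ = A * (2 * B * |s|) ^ m := by
          simp only [hA, mul_pow, pow_add _ k m]; field_simp
      _ ≤ A * (1 / 2) ^ m := by gcongr
      _ ≤ A * (1 / 2) ^ m₀ := by
          gcongr A * ?_
          exact pow_le_pow_of_le_one (by norm_num) (by norm_num) (by omega)
      _ < A * (ε / (2 * A)) := by gcongr
      _ = ε / 2 := by field_simp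
  have hmain : Tendsto (fun n => ∑ j ∈ Finset.range m, (s * Complex.I) ^ j / (j.factorial : ℂ) *
      (charMoment (μ n) (k + j) t - charMoment (ν n) (k + j) t)) atTop (𝓝 0) := by
    have := tendsto_finsetSum (Finset.range m) fun j _ =>
      (ht (k + j)).const_mul ((s * Complex.I) ^ j / (j.factorial : ℂ))
    simpa using this
  filter_upwards [hμB _ hev, hνB _ hev, (Metric.tendsto_nhds.1 hmain) (ε / 2) (by positivity)]
    with n h1 h2 h3
  rw [dist_zero_right] at h3 ⊢
  have e1 := norm_charMoment_add_sub_sum_le (hμ n) k m hev t s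
  have e2 := norm_charMoment_add_sub_sum_le (hν n) k m hev t s
  have g1 : |s| ^ m / m.factorial * ∫ x : ℝ, x ^ (k + m) ∂(μ n)
      ≤ |s| ^ m / m.factorial * (C * B ^ (k + m) * (k + m).factorial) := by gcongr
  have g2 : |s| ^ m / m.factorial * ∫ x : ℝ, x ^ (k + m) ∂(ν n)
      ≤ |s| ^ m / m.factorial * (C * B ^ (k + m) * (k + m).factorial) := by gcongr
  simp only [mul_sub, Finset.sum_sub_distrib] at h3
  set S1 := ∑ j ∈ Finset.range m,
    (s * Complex.I) ^ j / (j.factorial : ℂ) * charMoment (μ n) (k + j) t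
  set S2 := ∑ j ∈ Finset.range m,
    (s * Complex.I) ^ j / (j.factorial : ℂ) * charMoment (ν n) (k + j) t
  calc ‖charMoment (μ n) k (t + s) - charMoment (ν n) k (t + s)‖
      = ‖(charMoment (μ n) k (t + s) - S1) - (charMoment (ν n) k (t + s) - S2) + (S1 - S2)‖ := by
        congr 1; ring
    _ ≤ ‖charMoment (μ n) k (t + s) - S1‖ + ‖charMoment (ν n) k (t + s) - S2‖ + ‖S1 - S2‖ :=
        (norm_add_le _ _).trans (by gcongr; exact norm_sub_le _ _)
    _ < ε := by linarith

/-- Merging of moments implies merging of characteristic functions, if the even moments grow at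
most like `C * B ^ K * K!`. -/
lemma tendsto_charFun_sub_of_tendsto_moment_sub {μ ν : ℕ → Measure ℝ}
    (hμ : ∀ n k, Integrable (fun x : ℝ => x ^ k) (μ n))
    (hν : ∀ n k, Integrable (fun x : ℝ => x ^ k) (ν n)) {B C : ℝ} (hB : 0 < B) (hC : 0 < C)
    (hμB : ∀ K : ℕ, Even K → ∀ᶠ n in atTop, ∫ x : ℝ, x ^ K ∂(μ n) ≤ C * B ^ K * K.factorial)
    (hνB : ∀ K : ℕ, Even K → ∀ᶠ n in atTop, ∫ x : ℝ, x ^ K ∂(ν n) ≤ C * B ^ K * K.factorial)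
    (hmom : ∀ k : ℕ, Tendsto (fun n => ∫ x : ℝ, x ^ k ∂(μ n) - ∫ x : ℝ, x ^ k ∂(ν n)) atTop (𝓝 0))
    (t : ℝ) :
    Tendsto (fun n => charFun (μ n) t - charFun (ν n) t) atTop (𝓝 0) := by
  have key : ∀ p : ℕ, ∀ s : ℝ, |s| ≤ 1 / (4 * B) → ∀ k,
      Tendsto (fun n => charMoment (μ n) k (p * s) - charMoment (ν n) k (p * s)) atTop (𝓝 0) := by
    intro p
    induction p with
    | zero =>
      intro s _ k
      have := (Complex.continuous_ofReal.tendsto 0).comp (hmom k)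
      simpa [charMoment_zero_right, Function.comp_def] using this
    | succ p ih =>
      intro s hs k
      have := tendsto_charMoment_sub_add hμ hν hB hC hμB hνB (ih s hs) hs k
      simpa [add_mul] using this
  obtain ⟨p, hp⟩ := exists_nat_gt (4 * B * |t|)
  have hp0 : (0 : ℝ) < p := lt_of_le_of_lt (by positivity) hp
  have := key p (t / p) (by
    rw [abs_div, Nat.abs_cast, div_le_div_iff₀ hp0 (by positivity)]; linarith) 0
  simpa [charMoment_zero_left, mul_div_cancel₀ t hp0.ne'] using this

namespace IsCDF

variable {F G : StieltjesFunction ℝ}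

lemma nonneg (hF : IsCDF F) (x : ℝ) : 0 ≤ F x := F.mono.le_of_tendsto hF.tendsto_atBot x

lemma le_one (hF : IsCDF F) (x : ℝ) : F x ≤ 1 := F.mono.ge_of_tendsto hF.tendsto_atTop x

lemma isProbabilityMeasure (hF : IsCDF F) : IsProbabilityMeasure F.measure :=
  StieltjesFunction.isProbabilityMeasure F hF.tendsto_atBot hF.tendsto_atTop

lemma measureReal_Iic (hF : IsCDF F) (x : ℝ) : F.measure.real (Set.Iic x) = F x := by
  rw [measureReal_def, F.measure_Iic hF.tendsto_atBot, sub_zero,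
    ENNReal.toReal_ofReal (hF.nonneg x)]

lemma abs_sub_le_one (hF : IsCDF F) (hG : IsCDF G) (x : ℝ) : |F x - G x| ≤ 1 := by
  rw [abs_le]
  constructor <;> linarith [hF.nonneg x, hF.le_one x, hG.nonneg x, hG.le_one x]

lemma abs_sub_le_ksDist (hF : IsCDF F) (hG : IsCDF G) (x : ℝ) : |F x - G x| ≤ ksDist F G :=
  le_ciSup (f := fun x => |F x - G x|)
    ⟨1, by rintro _ ⟨y, rfl⟩; exact hF.abs_sub_le_one hG y⟩ x

end IsCDF

lemma ksDist_nonneg (F G : StieltjesFunction ℝ) : 0 ≤ ksDist F G :=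
  Real.iSup_nonneg fun _ => abs_nonneg _

/-- **Pólya's theorem** for two sequences of distribution functions with a common pointwise limit,
one of which is asymptotically Lipschitz. -/
lemma tendsto_ksDist_of_tendsto {F H : ℕ → StieltjesFunction ℝ} (hF : ∀ n, IsCDF (F n))
    (hH : ∀ n, IsCDF (H n)) {G : ℝ → ℝ} (hG0 : Tendsto G atBot (𝓝 0)) (hG1 : Tendsto G atTop (𝓝 1))
    (hFG : ∀ x, Tendsto (fun n => F n x) atTop (𝓝 (G x)))
    (hHG : ∀ x, Tendsto (fun n => H n x) atTop (𝓝 (G x))) {ξ : ℝ} (hξ : 0 < ξ)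
    (hc : ∀ a b ε : ℝ, 0 < ε → ∀ᶠ n in atTop, |F n b - F n a| ≤ ξ * |a - b| + ε) :
    Tendsto (fun n => ksDist (F n) (H n)) atTop (𝓝 0) := by
  suffices h : ∀ ε : ℝ, 0 < ε → ∀ᶠ n in atTop, ksDist (F n) (H n) ≤ 3 * ε by
    rw [Metric.tendsto_nhds]
    intro ε hε
    filter_upwards [h (ε / 4) (by positivity)] with n hn
    rw [Real.dist_0_eq_abs, abs_of_nonneg (ksDist_nonneg _ _)]
    linarith
  intro ε hε
  obtain ⟨a, ha⟩ := (hG0.eventually_lt_const hε).exists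
  obtain ⟨b, hb⟩ := (hG1.eventually_const_lt (show 1 - ε < 1 by linarith)).exists
  set δ : ℝ := ε / ξ with hδ
  have hδ0 : 0 < δ := by positivity
  have hξδ : ξ * δ = ε := by rw [hδ]; field_simp
  set N : ℕ := ⌊(b - a) / δ⌋₊ + 1
  have hdiff : ∀ x, ∀ᶠ n in atTop, |F n x - H n x| < ε := fun x => by
    have := (hFG x).sub (hHG x)
    rw [sub_self] at this
    simpa using (Metric.tendsto_nhds.1 this) ε hε
  have h1 : ∀ᶠ n in atTop, ∀ i ∈ Finset.range (N + 1),
      |F n (a + i * δ) - H n (a + i * δ)| < ε := by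
    rw [Filter.eventually_all_finset]
    exact fun i _ => hdiff _
  have h2 : ∀ᶠ n in atTop, ∀ i ∈ Finset.range N,
      |F n (a + (i + 1 : ℕ) * δ) - F n (a + i * δ)| ≤ 2 * ε := by
    rw [Filter.eventually_all_finset]
    intro i _
    filter_upwards [hc (a + i * δ) (a + (i + 1 : ℕ) * δ) ε hε] with n hn
    have : a + i * δ - (a + (i + 1 : ℕ) * δ) = -δ := by push_cast; ring
    rw [this, abs_neg, abs_of_pos hδ0, hξδ] at hn
    linarith
  filter_upwards [h1, h2, (hFG a).eventually_lt_const ha, (hHG a).eventually_lt_const ha,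
    (hFG b).eventually_const_lt hb, (hHG b).eventually_const_lt hb] with n h1 h2 hFa hHa hFb hHb
  refine ciSup_le fun x => ?_
  have := (hF n).nonneg x
  have := (hF n).le_one x
  have := (hH n).nonneg x
  have := (hH n).le_one x
  rcases le_total x a with hxa | hax
  · have := (F n).mono hxa
    have := (H n).mono hxa
    rw [abs_le]; constructor <;> linarith
  rcases le_total b x with hbx | hxb
  · have := (F n).mono hbx
    have := (H n).mono hbx
    rw [abs_le]; constructor <;> linarith
  set i : ℕ := ⌊(x - a) / δ⌋₊
  have hi0 : a + i * δ ≤ x := by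
    have := Nat.floor_le (show 0 ≤ (x - a) / δ from div_nonneg (by linarith) hδ0.le)
    rw [le_div_iff₀ hδ0] at this
    linarith
  have hi1 : x ≤ a + (i + 1 : ℕ) * δ := by
    have := (Nat.lt_floor_add_one ((x - a) / δ)).le
    rw [div_le_iff₀ hδ0] at this
    push_cast
    linarith
  have hiN : i < N := Nat.lt_succ_of_le (Nat.floor_mono (by gcongr))
  have e1 := abs_lt.1 (h1 i (Finset.mem_range.2 (by omega)))
  have e2 := abs_lt.1 (h1 (i + 1) (Finset.mem_range.2 (by omega)))
  have e3 := abs_le.1 (h2 i (Finset.mem_range.2 hiN))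
  have := (F n).mono hi0
  have := (F n).mono hi1
  have := (H n).mono hi0
  have := (H n).mono hi1
  rw [abs_le]; constructor <;> linarith

/-- A sequence of measures on `ℝ` with eventually bounded second moments is tight. -/
lemma isTightMeasureSet_range_of_eventually_moment_two_le {μ : ℕ → Measure ℝ}
    [∀ n, IsProbabilityMeasure (μ n)] (hμ : ∀ n, Integrable (fun x : ℝ => x ^ 2) (μ n)) {C : ℝ}
    (hC : ∀ᶠ n in atTop, ∫ x : ℝ, x ^ 2 ∂(μ n) ≤ C) :
    IsTightMeasureSet (Set.range μ) := by
  apply isTightMeasureSet_range_of_tendsto_limsup_measure_norm_gt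
  have hlim : Tendsto (fun r : ℝ => ENNReal.ofReal (C / r ^ 2)) atTop (𝓝 0) := by
    rw [← ENNReal.ofReal_zero]
    refine ENNReal.tendsto_ofReal (tendsto_const_nhds.div_atTop (tendsto_pow_atTop two_ne_zero))
  refine tendsto_of_tendsto_of_tendsto_of_le_of_le' tendsto_const_nhds hlim
    (Eventually.of_forall fun _ => zero_le) ?_
  filter_upwards [eventually_gt_atTop 0] with r hr
  refine limsup_le_of_le (by isBoundedDefault) ?_
  filter_upwards [hC] with n hn
  have hM := mul_meas_ge_le_integral_of_nonneg (μ := μ n) (f := fun x : ℝ => x ^ 2)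
    (Eventually.of_forall fun x => sq_nonneg x) (hμ n) (r ^ 2)
  have hsub : (μ n).real {x : ℝ | r < ‖x‖} ≤ (μ n).real {x : ℝ | r ^ 2 ≤ x ^ 2} := by
    refine measureReal_mono fun x (hx : r < |x|) => ?_
    rw [Set.mem_ofPred_eq, sq_le_sq, abs_of_pos hr]
    exact hx.le
  rw [← ofReal_measureReal]
  apply ENNReal.ofReal_le_ofReal
  rw [le_div_iff₀ (by positivity)]
  calc _ ≤ (μ n).real {x : ℝ | r ^ 2 ≤ x ^ 2} * r ^ 2 := by gcongr
    _ ≤ C := by linarith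

/-- Weak limits of asymptotically Lipschitz distribution functions have no atoms. -/
lemma measure_singleton_eq_zero_of_tendsto {F : ℕ → StieltjesFunction ℝ}
    {μ : ℕ → ProbabilityMeasure ℝ} (hμ : ∀ n, (μ n : Measure ℝ) = (F n).measure)
    {π : ProbabilityMeasure ℝ} (hπ : Tendsto μ atTop (𝓝 π)) {ξ : ℝ} (hξ : 0 < ξ)
    (hc : ∀ a b ε : ℝ, 0 < ε → ∀ᶠ n in atTop, |F n b - F n a| ≤ ξ * |a - b| + ε) (x : ℝ) :
    (π : Measure ℝ) {x} = 0 := by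
  have key : ∀ ε : ℝ, 0 < ε → (π : Measure ℝ) {x} ≤ ENNReal.ofReal (3 * ε) := by
    intro ε hε
    set δ := ε / ξ with hδ
    have hδ0 : 0 < δ := by positivity
    have hξδ : ξ * δ = ε := by rw [hδ]; field_simp
    calc (π : Measure ℝ) {x} ≤ (π : Measure ℝ) (Set.Ioo (x - δ) (x + δ)) :=
          measure_mono (by simp [hδ0])
      _ ≤ liminf (fun n => (μ n : Measure ℝ) (Set.Ioo (x - δ) (x + δ))) atTop :=
          ProbabilityMeasure.le_liminf_measure_open_of_tendsto hπ isOpen_Ioo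
      _ ≤ ENNReal.ofReal (3 * ε) := by
          refine liminf_le_of_le (by isBoundedDefault) fun c hcb => ?_
          obtain ⟨n, h1, h2⟩ := (hcb.and (hc (x - δ) (x + δ) ε hε)).exists
          refine h1.trans ?_
          rw [hμ n]
          refine (measure_mono Set.Ioo_subset_Ioc_self).trans ?_
          rw [StieltjesFunction.measure_Ioc]
          apply ENNReal.ofReal_le_ofReal
          have : x - δ - (x + δ) = -(2 * δ) := by ring
          rw [this, abs_neg, abs_of_pos (by positivity : 0 < 2 * δ)] at h2
          have := le_abs_self (F n (x + δ) - F n (x - δ))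
          linarith
  have hlim : Tendsto (fun ε : ℝ => ENNReal.ofReal (3 * ε)) (𝓝[>] 0) (𝓝 0) := by
    have : Tendsto (fun ε : ℝ => ENNReal.ofReal (3 * ε)) (𝓝 0) (𝓝 (ENNReal.ofReal (3 * 0))) :=
      (ENNReal.continuous_ofReal.comp (continuous_const_mul 3)).tendsto 0
    simp only [mul_zero, ENNReal.ofReal_zero] at this
    exact this.mono_left nhdsWithin_le_nhds
  exact le_antisymm (ge_of_tendsto hlim (eventually_mem_nhdsWithin.mono fun ε hε => key ε hε))
    zero_le

/-- Deterministic comparison principle: if the moments of two sequences of distribution functions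
merge, one of them has even moments growing at most like `C * B ^ K * K!` and is asymptotically
Lipschitz, then their Kolmogorov-Smirnov distance tends to `0` along a subsequence. -/
theorem exists_subseq_tendsto_ksDist {F H : ℕ → StieltjesFunction ℝ} (hF : ∀ n, IsCDF (F n))
    (hH : ∀ n, IsCDF (H n)) (hFmom : ∀ n, HasAllMoments (F n)) (hHmom : ∀ n, HasAllMoments (H n))
    {B C : ℝ} (hB : 1 ≤ B) (hC : 0 < C)
    (hFB : ∀ K : ℕ, Even K → ∀ᶠ n in atTop, cdfMoment K (F n) ≤ C * B ^ K * K.factorial)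
    (hmom : ∀ k : ℕ, Tendsto (fun n => cdfMoment k (F n) - cdfMoment k (H n)) atTop (𝓝 0))
    {ξ : ℝ} (hξ : 0 < ξ)
    (hc : ∀ a b ε : ℝ, 0 < ε → ∀ᶠ n in atTop, |F n b - F n a| ≤ ξ * |a - b| + ε) :
    ∃ φ : ℕ → ℕ, StrictMono φ ∧
      Tendsto (fun n => ksDist (F (φ n)) (H (φ n))) atTop (𝓝 0) := by
  have hFp := fun n => (hF n).isProbabilityMeasure
  have hHp := fun n => (hH n).isProbabilityMeasure
  have hone : ∀ K : ℕ, 1 ≤ B ^ K * K.factorial := fun K =>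
    one_le_mul_of_one_le_of_one_le (one_le_pow₀ hB) (by exact_mod_cast K.factorial_pos)
  have hFB' : ∀ K : ℕ, Even K →
      ∀ᶠ n in atTop, ∫ x : ℝ, x ^ K ∂(F n).measure ≤ (C + 1) * B ^ K * K.factorial := by
    intro K hK
    filter_upwards [hFB K hK] with n hn
    have := hone K
    unfold cdfMoment at hn
    linarith
  have hHB : ∀ K : ℕ, Even K →
      ∀ᶠ n in atTop, ∫ x : ℝ, x ^ K ∂(H n).measure ≤ (C + 1) * B ^ K * K.factorial := by
    intro K hK
    filter_upwards [hFB K hK, (hmom K).eventually_const_lt (show (-1 : ℝ) < 0 by norm_num)]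
      with n hn hn'
    have := hone K
    unfold cdfMoment at hn hn'
    linarith
  have hchar := tendsto_charFun_sub_of_tendsto_moment_sub (μ := fun n => (F n).measure)
    (ν := fun n => (H n).measure) hFmom hHmom (by linarith : 0 < B) (by linarith : 0 < C + 1)
    hFB' hHB hmom
  let μ : ℕ → ProbabilityMeasure ℝ := fun n => ⟨(F n).measure, hFp n⟩
  let ν : ℕ → ProbabilityMeasure ℝ := fun n => ⟨(H n).measure, hHp n⟩
  have htight : IsTightMeasureSet
      {((ρ : ProbabilityMeasure ℝ) : Measure ℝ) | ρ ∈ Set.range μ} := by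
    have := isTightMeasureSet_range_of_eventually_moment_two_le
      (μ := fun n => (F n).measure) (fun n => hFmom n 2) (hFB' 2 even_two)
    refine this.subset ?_
    rintro _ ⟨_, ⟨n, rfl⟩, rfl⟩
    exact ⟨n, rfl⟩
  obtain ⟨π, -, φ, hφ, hπ⟩ := (isCompact_closure_of_isTightMeasureSet htight).tendsto_subseq
    (x := μ) (fun n => subset_closure ⟨n, rfl⟩)
  have hπ' : Tendsto (ν ∘ φ) atTop (𝓝 π) := by
    rw [ProbabilityMeasure.tendsto_iff_tendsto_charFun] at hπ ⊢
    intro t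
    have h := (hπ t).sub ((hchar t).comp hφ.tendsto_atTop)
    rw [sub_zero] at h
    refine h.congr fun n => ?_
    exact sub_sub_cancel (charFun (F (φ n)).measure t) (charFun (H (φ n)).measure t)
  have hcφ : ∀ a b ε : ℝ, 0 < ε →
      ∀ᶠ n in atTop, |F (φ n) b - F (φ n) a| ≤ ξ * |a - b| + ε :=
    fun a b ε hε => hφ.tendsto_atTop.eventually (hc a b ε hε)
  have hatom : ∀ x, π (frontier (Set.Iic x)) = 0 := fun x => by
    have := measure_singleton_eq_zero_of_tendsto (F := fun n => F (φ n)) (fun n => rfl) hπ hξ hcφ x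
    rw [frontier_Iic]
    simpa [ProbabilityMeasure.null_iff_toMeasure_null] using this
  have hconv : ∀ {ρ : ℕ → ProbabilityMeasure ℝ}, Tendsto ρ atTop (𝓝 π) → ∀ x,
      Tendsto (fun n => (ρ n : Measure ℝ).real (Set.Iic x)) atTop
        (𝓝 (cdf (π : Measure ℝ) x)) := by
    intro ρ hρ x
    rw [cdf_eq_real]
    exact (NNReal.tendsto_coe.2
      (ProbabilityMeasure.tendsto_measure_of_null_frontier_of_tendsto hρ (hatom x)))
  refine ⟨φ, hφ, tendsto_ksDist_of_tendsto (fun n => hF (φ n)) (fun n => hH (φ n))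
    (tendsto_cdf_atBot (π : Measure ℝ)) (tendsto_cdf_atTop (π : Measure ℝ)) (fun x => ?_)
    (fun x => ?_) hξ hcφ⟩
  · exact (hconv hπ x).congr fun n => (hF (φ n)).measureReal_Iic x
  · exact (hconv hπ' x).congr fun n => (hH (φ n)).measureReal_Iic x

/-- Uniform version of the comparison principle: far enough in the sequence, any distribution
function with sufficiently many sufficiently close moments is close in Kolmogorov-Smirnov
distance. -/
theorem exists_moment_close_imp_ksDist_lt {F : ℕ → StieltjesFunction ℝ} (hF : ∀ n, IsCDF (F n))
    (hFmom : ∀ n, HasAllMoments (F n)) {B C : ℝ} (hB : 1 ≤ B) (hC : 0 < C)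
    (hFB : ∀ K : ℕ, Even K → ∀ᶠ n in atTop, cdfMoment K (F n) ≤ C * B ^ K * K.factorial)
    {ξ : ℝ} (hξ : 0 < ξ)
    (hc : ∀ a b ε : ℝ, 0 < ε → ∀ᶠ n in atTop, |F n b - F n a| ≤ ξ * |a - b| + ε)
    {ε : ℝ} (hε : 0 < ε) :
    ∃ (K : ℕ) (δ : ℝ), 0 < δ ∧ ∀ᶠ n in atTop, ∀ H : StieltjesFunction ℝ, IsCDF H →
      HasAllMoments H → (∀ k ∈ Finset.range K, |cdfMoment k H - cdfMoment k (F n)| < δ) →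
        ksDist (F n) H < ε := by
  by_contra! hcon
  have hsel : ∀ K : ℕ, ∃ n, K ≤ n ∧ ∃ H : StieltjesFunction ℝ, IsCDF H ∧ HasAllMoments H ∧
      (∀ k ∈ Finset.range K, |cdfMoment k H - cdfMoment k (F n)| < 1 / (K + 1 : ℝ)) ∧
      ε ≤ ksDist (F n) H := fun K =>
    frequently_atTop.1 (hcon K (1 / (K + 1 : ℝ)) (by positivity)) K
  choose M hM H hH hHmom hclose hfar using hsel
  have hMtop : Tendsto M atTop atTop := tendsto_atTop_mono hM tendsto_id
  obtain ⟨φ, -, hφ⟩ := exists_subseq_tendsto_ksDist (F := fun n => F (M n)) (H := H)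
    (fun n => hF _) hH (fun n => hFmom _) hHmom hB hC
    (fun K hK => hMtop.eventually (hFB K hK)) (fun k => by
      refine squeeze_zero_norm' ?_ tendsto_one_div_add_atTop_nhds_zero_nat
      filter_upwards [eventually_gt_atTop k] with n hn
      rw [Real.norm_eq_abs, abs_sub_comm]
      exact (hclose n k (Finset.mem_range.2 hn)).le)
    hξ (fun a b ε hε => hMtop.eventually (hc a b ε hε))
  exact absurd (ge_of_tendsto' hφ fun n => hfar (φ n)) (not_le.2 hε)

/-- Convergence in probability of all moments of random distribution functions implies convergence
in probability of the Kolmogorov-Smirnov distance. -/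
theorem tendstoInMeasure_ksDist {Ω : Type*} [MeasurableSpace Ω] (P : Measure Ω)
    {F : ℕ → StieltjesFunction ℝ} {Ft : ℕ → Ω → StieltjesFunction ℝ}
    (hF : ∀ n, IsCDF (F n)) (hFt : ∀ n ω, IsCDF (Ft n ω)) (hFmom : ∀ n, HasAllMoments (F n))
    (hFtmom : ∀ n, ∀ᵐ ω ∂P, HasAllMoments (Ft n ω)) {B C : ℝ} (hB : 1 ≤ B) (hC : 0 < C)
    (hFB : ∀ K : ℕ, Even K → ∀ᶠ n in atTop, cdfMoment K (F n) ≤ C * B ^ K * K.factorial)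
    (hb : ∀ k : ℕ, TendstoInMeasure P
      (fun n ω => cdfMoment k (Ft n ω) - cdfMoment k (F n)) atTop (fun _ => (0 : ℝ)))
    {ξ : ℝ} (hξ : 0 < ξ)
    (hc : ∀ a b ε : ℝ, 0 < ε → ∀ᶠ n in atTop, |F n b - F n a| ≤ ξ * |a - b| + ε) :
    TendstoInMeasure P (fun n ω => ksDist (F n) (Ft n ω)) atTop (fun _ => (0 : ℝ)) := by
  rw [tendstoInMeasure_iff_norm]
  intro ε hε
  obtain ⟨K, δ, hδ, hev⟩ := exists_moment_close_imp_ksDist_lt hF hFmom hB hC hFB hξ hc hε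
  have hsum : Tendsto (fun n => ∑ k ∈ Finset.range K,
      P {ω | δ ≤ ‖cdfMoment k (Ft n ω) - cdfMoment k (F n) - 0‖}) atTop (𝓝 0) := by
    have := tendsto_finsetSum (Finset.range K) fun k _ =>
      (tendstoInMeasure_iff_norm.1 (hb k)) δ hδ
    simpa using this
  refine tendsto_of_tendsto_of_tendsto_of_le_of_le' tendsto_const_nhds hsum
    (Eventually.of_forall fun _ => zero_le) ?_
  filter_upwards [hev] with n hn
  refine (measure_mono_ae ?_).trans (measure_biUnion_finset_le (Finset.range K) _)
  filter_upwards [hFtmom n] with ω hω hfar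
  by_contra hnot
  have hlt := hn (Ft n ω) (hFt n ω) hω fun k hk => by
    by_contra hk'
    refine hnot (Set.mem_biUnion (x := k) hk ?_)
    simpa using hk'
  have hfar' : ε ≤ ‖ksDist (F n) (Ft n ω) - 0‖ := hfar
  rw [sub_zero, Real.norm_of_nonneg (ksDist_nonneg _ _)] at hfar'
  linarith

namespace IsCDF

variable {F G : StieltjesFunction ℝ} {p x : ℝ}

lemma bddBelow_setOf_le (hF : IsCDF F) (hp : 0 < p) : BddBelow {x : ℝ | p ≤ F x} := by
  obtain ⟨a, ha⟩ := (hF.tendsto_atBot.eventually_lt_const hp).exists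
  refine ⟨a, fun x (hx : p ≤ F x) => ?_⟩
  by_contra! hxa
  linarith [F.mono hxa.le]

lemma nonempty_setOf_le (hF : IsCDF F) (hp : p < 1) : {x : ℝ | p ≤ F x}.Nonempty := by
  obtain ⟨a, ha⟩ := (hF.tendsto_atTop.eventually_const_lt hp).exists
  exact ⟨a, ha.le⟩

lemma cdfQuantile_le (hF : IsCDF F) (hp : 0 < p) (hx : p ≤ F x) : cdfQuantile F p ≤ x :=
  csInf_le (hF.bddBelow_setOf_le hp) hx

lemma lt_of_lt_cdfQuantile (hF : IsCDF F) (hp : 0 < p) (hx : x < cdfQuantile F p) : F x < p := by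
  by_contra! h
  exact absurd (hF.cdfQuantile_le hp h) (not_le.2 hx)

lemma le_apply_cdfQuantile (hF : IsCDF F) (hp : p < 1) : p ≤ F (cdfQuantile F p) := by
  have hlim : Tendsto F (𝓝[>] (cdfQuantile F p)) (𝓝 (F (cdfQuantile F p))) :=
    (F.right_continuous _).mono_left (nhdsWithin_mono _ Set.Ioi_subset_Ici_self)
  refine ge_of_tendsto hlim (eventually_mem_nhdsWithin.mono fun y hy => ?_)
  obtain ⟨z, hz, hzy⟩ := exists_lt_of_csInf_lt (hF.nonempty_setOf_le hp) hy
  exact le_trans hz (F.mono hzy.le)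

lemma measureReal_Ioi_cdfQuantile_le (hF : IsCDF F) (hp : p < 1) :
    F.measure.real (Set.Ioi (cdfQuantile F p)) ≤ 1 - p := by
  rw [measureReal_def, F.measure_Ioi hF.tendsto_atTop,
    ENNReal.toReal_ofReal (by linarith [hF.le_one (cdfQuantile F p)])]
  linarith [hF.le_apply_cdfQuantile hp]

lemma le_measureReal_Ici_cdfQuantile (hF : IsCDF F) (hp0 : 0 < p) (hp1 : p ≤ 1) :
    1 - p ≤ F.measure.real (Set.Ici (cdfQuantile F p)) := by
  have hle : Function.leftLim F (cdfQuantile F p) ≤ p :=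
    le_of_tendsto (F.mono.tendsto_leftLim _) (eventually_mem_nhdsWithin.mono fun y hy =>
      (hF.lt_of_lt_cdfQuantile hp0 hy).le)
  rw [measureReal_def, F.measure_Ici hF.tendsto_atTop, ENNReal.toReal_ofReal (by linarith)]
  linarith

lemma cdfQuantile_sub_le (hF : IsCDF F) (hG : IsCDF G) {ε : ℝ} (hp : ε < p) (hp1 : p < 1)
    (h : ksDist F G ≤ ε) : cdfQuantile F (p - ε) ≤ cdfQuantile G p := by
  refine hF.cdfQuantile_le (by linarith) ?_
  have := (abs_le.1 ((hF.abs_sub_le_ksDist hG (cdfQuantile G p)).trans h)).1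
  linarith [hG.le_apply_cdfQuantile hp1]

lemma cdfQuantile_le_add (hF : IsCDF F) (hG : IsCDF G) {ε : ℝ} (hp : 0 < p) (hp1 : p + ε < 1)
    (h : ksDist F G ≤ ε) : cdfQuantile G p ≤ cdfQuantile F (p + ε) := by
  refine hG.cdfQuantile_le hp ?_
  have := (abs_le.1 ((hF.abs_sub_le_ksDist hG (cdfQuantile F (p + ε))).trans h)).2
  linarith [hF.le_apply_cdfQuantile hp1]

end IsCDF

section Coverage

variable {Ω : Type*} [MeasurableSpace Ω] {P : Measure Ω} [IsProbabilityMeasure P]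
  {F : ℕ → StieltjesFunction ℝ} {Ft : ℕ → Ω → StieltjesFunction ℝ} {Δ : ℕ → Ω → ℝ} {α : ℝ}

lemma eventually_measureReal_ksDist_gt_le
    (hks : TendstoInMeasure P (fun n ω => ksDist (F n) (Ft n ω)) atTop (fun _ => (0 : ℝ)))
    {ε : ℝ} (hε : 0 < ε) : ∀ᶠ n in atTop, P.real {ω | ε < ksDist (F n) (Ft n ω)} ≤ ε := by
  filter_upwards [(tendstoInMeasure_iff_measureReal_norm.1 hks ε hε).eventually_lt_const hε]
    with n hn
  refine (measureReal_mono fun ω (hω : ε < _) => ?_).trans hn.le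
  change ε ≤ ‖_ - (0 : ℝ)‖
  rw [sub_zero, Real.norm_of_nonneg (ksDist_nonneg _ _)]
  exact hω.le

lemma eventually_measureReal_quantile_lt_le (hF : ∀ n, IsCDF (F n)) (hFt : ∀ n ω, IsCDF (Ft n ω))
    (hks : TendstoInMeasure P (fun n ω => ksDist (F n) (Ft n ω)) atTop (fun _ => (0 : ℝ)))
    (hΔ : ∀ n, HasLaw (Δ n) (F n).measure P) (hα : 0 < α) {ε : ℝ} (hε : 0 < ε) :
    ∀ᶠ n in atTop, P.real {ω | cdfQuantile (Ft n ω) (1 - α) < Δ n ω} ≤ α + 2 * ε := by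
  rcases le_or_gt (1 - α) ε with h | h
  · exact Eventually.of_forall fun n => measureReal_le_one.trans (by linarith)
  filter_upwards [eventually_measureReal_ksDist_gt_le hks hε] with n hn
  have hq : P.real {ω | cdfQuantile (F n) (1 - α - ε) < Δ n ω} ≤ α + ε := by
    have := (hF n).measureReal_Ioi_cdfQuantile_le (p := 1 - α - ε) (by linarith)
    rw [(hΔ n).measureReal_eq (p := fun x => cdfQuantile (F n) (1 - α - ε) < x) measurableSet_Ioi]
    exact this.trans (by linarith)
  have hsub : {ω | cdfQuantile (Ft n ω) (1 - α) < Δ n ω} ⊆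
      {ω | cdfQuantile (F n) (1 - α - ε) < Δ n ω} ∪ {ω | ε < ksDist (F n) (Ft n ω)} := by
    intro ω (hω : cdfQuantile (Ft n ω) (1 - α) < Δ n ω)
    by_cases hk : ksDist (F n) (Ft n ω) ≤ ε
    · exact Or.inl (((hF n).cdfQuantile_sub_le (hFt n ω) h (by linarith) hk).trans_lt hω)
    · exact Or.inr (not_le.1 hk)
  linarith [(measureReal_mono (μ := P) hsub).trans (measureReal_union_le _ _)]

lemma eventually_le_measureReal_quantile_le (hF : ∀ n, IsCDF (F n)) (hFt : ∀ n ω, IsCDF (Ft n ω))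
    (hks : TendstoInMeasure P (fun n ω => ksDist (F n) (Ft n ω)) atTop (fun _ => (0 : ℝ)))
    (hΔ : ∀ n, HasLaw (Δ n) (F n).measure P) (hα : α < 1) {ε : ℝ} (hε : 0 < ε) :
    ∀ᶠ n in atTop, α - 2 * ε ≤ P.real {ω | cdfQuantile (Ft n ω) (1 - α) < Δ n ω}
      + P.real {ω | Δ n ω = cdfQuantile (Ft n ω) (1 - α)} := by
  rcases le_or_gt α ε with h | h
  · exact Eventually.of_forall fun n =>
      (by linarith : α - 2 * ε ≤ 0).trans (add_nonneg measureReal_nonneg measureReal_nonneg)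
  filter_upwards [eventually_measureReal_ksDist_gt_le hks hε] with n hn
  have hq : α - ε ≤ P.real {ω | cdfQuantile (F n) (1 - α + ε) ≤ Δ n ω} := by
    have := (hF n).le_measureReal_Ici_cdfQuantile (p := 1 - α + ε) (by linarith) (by linarith)
    rw [(hΔ n).measureReal_eq (p := fun x => cdfQuantile (F n) (1 - α + ε) ≤ x) measurableSet_Ici]
    exact le_trans (by linarith) this
  have hsub : {ω | cdfQuantile (F n) (1 - α + ε) ≤ Δ n ω} ⊆
      ({ω | cdfQuantile (Ft n ω) (1 - α) < Δ n ω} ∪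
        {ω | Δ n ω = cdfQuantile (Ft n ω) (1 - α)}) ∪ {ω | ε < ksDist (F n) (Ft n ω)} := by
    intro ω (hω : cdfQuantile (F n) (1 - α + ε) ≤ Δ n ω)
    by_cases hk : ksDist (F n) (Ft n ω) ≤ ε
    · have := ((hF n).cdfQuantile_le_add (hFt n ω) (by linarith) (by linarith) hk).trans hω
      exact Or.inl (this.lt_or_eq.imp id Eq.symm)
    · exact Or.inr (not_le.1 hk)
  have h1 := (measureReal_mono (μ := P) hsub).trans (measureReal_union_le _ _)
  have h2 := measureReal_union_le (μ := P) {ω | cdfQuantile (Ft n ω) (1 - α) < Δ n ω}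
    {ω | Δ n ω = cdfQuantile (Ft n ω) (1 - α)}
  linarith

end Coverage

theorem mainTheorem6 {Ω : Type*} [MeasurableSpace Ω] (P : Measure Ω) [IsProbabilityMeasure P]
    (F : ℕ → StieltjesFunction ℝ) (Ft : ℕ → Ω → StieltjesFunction ℝ)
    (hF : ∀ M, IsCDF (F M)) (hFt : ∀ M, IsRandomCDF (Ft M))
    (hFmom : ∀ M, HasAllMoments (F M)) (hFtmom : ∀ M, ∀ᵐ ω ∂P, HasAllMoments (Ft M ω))
    (L : ℝ) (hL : 0 ≤ L)
    (ha : ∀ K : ℕ, limsup (fun M => ((cdfMoment K (F M) : ℝ) : EReal)) atTop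
      ≤ ((L ^ K * (K.factorial : ℝ) : ℝ) : EReal))
    (hb : ∀ k : ℕ, TendstoInMeasure P
      (fun M ω => cdfMoment k (Ft M ω) - cdfMoment k (F M)) atTop (fun _ => (0 : ℝ)))
    (ξ : ℝ) (hξ : 0 < ξ)
    (hc : ∀ a b : ℝ, limsup (fun M => |F M b - F M a|) atTop ≤ ξ * |a - b|) :
    TendstoInMeasure P (fun M ω => ksDist (F M) (Ft M ω)) atTop (fun _ => (0 : ℝ)) ∧
    ∀ Δ : ℕ → Ω → ℝ, (∀ M, HasLaw (Δ M) (F M).measure P) →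
      ∀ α : ℝ, 0 < α → α < 1 →
        limsup (fun M => P.real {ω | cdfQuantile (Ft M ω) (1 - α) < Δ M ω}) atTop ≤ α ∧
        (limsup (fun M => P.real {ω | Δ M ω = cdfQuantile (Ft M ω) (1 - α)}) atTop = 0 →
          Tendsto (fun M => P.real {ω | cdfQuantile (Ft M ω) (1 - α) < Δ M ω}) atTop (𝓝 α)) := by
  have hFtc : ∀ M ω, IsCDF (Ft M ω) := fun M => (hFt M).isCDF
  have hFB : ∀ K : ℕ, Even K →
      ∀ᶠ M in atTop, cdfMoment K (F M) ≤ 2 * (max L 1) ^ K * K.factorial := by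
    intro K _
    have hone : 1 ≤ (max L 1) ^ K * (K.factorial : ℝ) :=
      one_le_mul_of_one_le_of_one_le (one_le_pow₀ (le_max_right _ _))
        (by exact_mod_cast K.factorial_pos)
    have hLK : L ^ K * (K.factorial : ℝ) ≤ (max L 1) ^ K * K.factorial := by
      gcongr
      exact le_max_left _ _
    have hlt : ((L ^ K * (K.factorial : ℝ) : ℝ) : EReal) <
        ((L ^ K * (K.factorial : ℝ) + 1 : ℝ) : EReal) := EReal.coe_lt_coe_iff.2 (lt_add_one _)
    filter_upwards [eventually_lt_of_limsup_lt ((ha K).trans_lt hlt)] with M hM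
    have := EReal.coe_lt_coe_iff.1 hM
    linarith
  have hc' : ∀ a b ε : ℝ, 0 < ε → ∀ᶠ M in atTop, |F M b - F M a| ≤ ξ * |a - b| + ε := by
    intro a b ε hε
    have hbdd : IsBoundedUnder (· ≤ ·) atTop fun M => |F M b - F M a| :=
      isBoundedUnder_of ⟨1, fun M => by
        have := (hF M).nonneg a
        have := (hF M).le_one a
        have := (hF M).nonneg b
        have := (hF M).le_one b
        rw [abs_le]; constructor <;> linarith⟩
    exact (eventually_lt_of_limsup_lt ((hc a b).trans_lt (lt_add_of_pos_right _ hε)) hbdd).mono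
      fun _ h => h.le
  have hks := tendstoInMeasure_ksDist P hF hFtc hFmom hFtmom (le_max_right L 1) two_pos hFB hb
    hξ hc'
  refine ⟨hks, fun Δ hΔ α hα0 hα1 => ⟨?_, fun hatom => ?_⟩⟩
  · refine le_of_forall_pos_le_add fun ε hε => ?_
    have hcob : IsCoboundedUnder (· ≤ ·) atTop
        fun M => P.real {ω | cdfQuantile (Ft M ω) (1 - α) < Δ M ω} :=
      (isBoundedUnder_of ⟨0, fun _ => measureReal_nonneg⟩ :
        IsBoundedUnder (· ≥ ·) atTop _).isCoboundedUnder_le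
    refine limsup_le_of_le hcob ?_
    filter_upwards [eventually_measureReal_quantile_lt_le hF hFtc hks hΔ hα0 (half_pos hε)]
      with M hM
    linarith
  · rw [Metric.tendsto_nhds]
    intro ε hε
    have hbdd : IsBoundedUnder (· ≤ ·) atTop
        fun M => P.real {ω | Δ M ω = cdfQuantile (Ft M ω) (1 - α)} :=
      isBoundedUnder_of ⟨1, fun _ => measureReal_le_one⟩
    have hε4 : 0 < ε / 4 := by positivity
    filter_upwards [eventually_measureReal_quantile_lt_le hF hFtc hks hΔ hα0 hε4,
      eventually_le_measureReal_quantile_le hF hFtc hks hΔ hα1 hε4,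
      eventually_lt_of_limsup_lt (hatom.trans_lt hε4) hbdd] with M h1 h2 h3
    rw [Real.dist_eq, abs_lt]
    constructor <;> linarith
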